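/- Let $\Omega=B_1(0)\subset\mathbb R^2$ be the open unit disk, let $\lambda>0$, and let $\Theta$ be the parameter set of some neural network architecture whose realizations satisfy $u_\theta\in H^1(\Omega)$ for all $\theta\in\Theta$ (the structure of the network plays no role: $\Theta$ may be any set and $\theta\mapsto u_\theta$ any map into $H^1(\Omega)$). Let $u_0\in H^1_0(\Omega)$ be the weak solution of the Dirichlet problem $$-\Delta u=1\ \text{ in }\Omega,\qquad u=0\ \text{ on }\partial\Omega,$$ and let $u_\lambda\in H^1(\Omega)$ be the weak solution of the Robin problem $$-\Delta u=1\ \text{ in }\Omega,\qquad \partial_n u+2\lambda u=0\ \text{ on }\partial\Omega.$$ For $\theta\in\Theta$ set $$\mathcal L_\lambda(\theta)=\frac12\int_\Omega|\nabla u_\theta|^2\,dx-\int_\Omega u_\theta\,dx+\lambda\int_{\partial\Omega}u_\theta^2\,ds,\qquad \delta_\lambda=\mathcal L_\lambda(\theta)-\inf_{\tilde\theta\in\Theta}\mathcal L_\lambda(\tilde\theta),$$ and for $v\in H^1(\Omega)$ set $\|v\|_\lambda^2=\|\nabla v\|_{L^2(\Omega)}^2+\lambda\|v\|_{L^2(\partial\Omega)}^2$,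 where boundary values are understood in the trace sense, and $\|v\|_{H^1(\Omega)}^2=\|v\|_{L^2(\Omega)}^2+\|\nabla v\|_{L^2(\Omega)}^2$. Then for every $\theta\in\Theta$ $$\|u_\theta-u_0\|_{H^1(\Omega)}\le\sqrt{\frac{8+10\lambda}{\lambda}\,\delta_\lambda+\frac{4+5\lambda}{\lambda}\inf_{\tilde\theta\in\Theta}\|u_{\tilde\theta}-u_\lambda\|_\lambda^2}+\frac{\pi}{4\lambda}.$$ -/

import Mathlib

open MeasureTheory Filter Topology
open scoped ContDiff

noncomputable section

namespace DeepRitz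

/-- The Euclidean plane `ℝ²`. -/
abbrev Plane : Type := EuclideanSpace ℝ (Fin 2)

/-- `φ ∈ C_c^∞(Ω)`. -/
structure IsTestFunction (Ω : Set Plane) (φ : Plane → ℝ) : Prop where
  smooth : ContDiff ℝ ∞ φ
  compact : HasCompactSupport φ
  support : tsupport φ ⊆ Ω

/-- `L²(Ω)`, real valued. -/
abbrev L2 (Ω : Set Plane) : Type := Lp ℝ 2 (volume.restrict Ω)

/-- `L²(Ω; ℝ²)`. -/
abbrev L2Vec (Ω : Set Plane) : Type := Lp Plane 2 (volume.restrict Ω)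

/-- `G` is the weak gradient of `u` on `Ω`: for every test function `φ` and every direction `v`,
`∫_Ω u ∂_v φ = - ∫_Ω (G · v) φ`. -/
def IsWeakGradient (Ω : Set Plane) (u : L2 Ω) (G : L2Vec Ω) : Prop :=
  ∀ φ : Plane → ℝ, IsTestFunction Ω φ → ∀ v : Plane,
    ∫ x in Ω, u x * fderiv ℝ φ x v = - ∫ x in Ω, inner ℝ (G x) v * φ x

theorem IsTestFunction.memLp {Ω : Set Plane} {φ : Plane → ℝ} (h : IsTestFunction Ω φ) :
    MemLp φ 2 (volume.restrict Ω) :=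
  (h.smooth.continuous.memLp_of_hasCompactSupport h.compact).restrict Ω

theorem IsTestFunction.memLp_fderiv {Ω : Set Plane} {φ : Plane → ℝ} (h : IsTestFunction Ω φ)
    (v : Plane) : MemLp (fun x => fderiv ℝ φ x v) 2 (volume.restrict Ω) := by
  have hc : Continuous (fun x => fderiv ℝ φ x v) :=
    (h.smooth.continuous_fderiv (by simp)).clm_apply continuous_const
  exact (hc.memLp_of_hasCompactSupport (h.compact.fderiv_apply (𝕜 := ℝ) v)).restrict Ω

theorem integrable_mul_fderiv {Ω : Set Plane} {φ : Plane → ℝ} (h : IsTestFunction Ω φ)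
    (u : L2 Ω) (v : Plane) :
    Integrable (fun x => u x * fderiv ℝ φ x v) (volume.restrict Ω) :=
  (Lp.memLp u).integrable_mul (h.memLp_fderiv v)

theorem integrable_inner_mul {Ω : Set Plane} {φ : Plane → ℝ} (h : IsTestFunction Ω φ)
    (G : L2Vec Ω) (v : Plane) :
    Integrable (fun x => inner ℝ (G x) v * φ x) (volume.restrict Ω) :=
  ((Lp.memLp G).inner_const v).integrable_mul h.memLp

/-- The Sobolev space `H¹(Ω)`, realised as the space of pairs `(u, ∇u)` of an `L²` function and
its weak gradient in `L²`. The norm inherited from the `ℓ²`-product is the usual one,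
`‖u‖² = ‖u‖²_{L²(Ω)} + ‖∇u‖²_{L²(Ω)}`. -/
def H1 (Ω : Set Plane) : Submodule ℝ (WithLp 2 (L2 Ω × L2Vec Ω)) where
  carrier := {p | IsWeakGradient Ω p.fst p.snd}
  zero_mem' := by
    intro φ _ v
    have h1 : ∫ x in Ω, (0 : L2 Ω) x * fderiv ℝ φ x v = 0 := by
      refine integral_eq_zero_of_ae ?_
      filter_upwards [Lp.coeFn_zero ℝ 2 (volume.restrict Ω)] with x hx
      rw [hx]; simp
    have h2 : ∫ x in Ω, inner ℝ ((0 : L2Vec Ω) x) v * φ x = 0 := by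
      refine integral_eq_zero_of_ae ?_
      filter_upwards [Lp.coeFn_zero Plane 2 (volume.restrict Ω)] with x hx
      rw [hx]; simp
    change ∫ x in Ω, (0 : L2 Ω) x * fderiv ℝ φ x v
      = - ∫ x in Ω, inner ℝ ((0 : L2Vec Ω) x) v * φ x
    rw [h1, h2, neg_zero]
  add_mem' := by
    intro p q hp hq φ hφ v
    have h1 : ∫ x in Ω, (p.fst + q.fst : L2 Ω) x * fderiv ℝ φ x v
        = (∫ x in Ω, p.fst x * fderiv ℝ φ x v) + ∫ x in Ω, q.fst x * fderiv ℝ φ x v := by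
      rw [← integral_add (integrable_mul_fderiv hφ p.fst v) (integrable_mul_fderiv hφ q.fst v)]
      refine integral_congr_ae ?_
      filter_upwards [Lp.coeFn_add p.fst q.fst] with x hx
      rw [hx, Pi.add_apply, add_mul]
    have h2 : ∫ x in Ω, inner ℝ ((p.snd + q.snd : L2Vec Ω) x) v * φ x
        = (∫ x in Ω, inner ℝ (p.snd x) v * φ x) + ∫ x in Ω, inner ℝ (q.snd x) v * φ x := by
      rw [← integral_add (integrable_inner_mul hφ p.snd v) (integrable_inner_mul hφ q.snd v)]
      refine integral_congr_ae ?_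
      filter_upwards [Lp.coeFn_add p.snd q.snd] with x hx
      rw [hx, Pi.add_apply, inner_add_left, add_mul]
    change ∫ x in Ω, (p.fst + q.fst : L2 Ω) x * fderiv ℝ φ x v
      = - ∫ x in Ω, inner ℝ ((p.snd + q.snd : L2Vec Ω) x) v * φ x
    rw [h1, h2, hp φ hφ v, hq φ hφ v, neg_add]
  smul_mem' := by
    intro c p hp φ hφ v
    have h1 : ∫ x in Ω, (c • p.fst : L2 Ω) x * fderiv ℝ φ x v
        = c * ∫ x in Ω, p.fst x * fderiv ℝ φ x v := by
      rw [← integral_const_mul]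
      refine integral_congr_ae ?_
      filter_upwards [Lp.coeFn_smul c p.fst] with x hx
      rw [hx, Pi.smul_apply, smul_eq_mul, mul_assoc]
    have h2 : ∫ x in Ω, inner ℝ ((c • p.snd : L2Vec Ω) x) v * φ x
        = c * ∫ x in Ω, inner ℝ (p.snd x) v * φ x := by
      rw [← integral_const_mul]
      refine integral_congr_ae ?_
      filter_upwards [Lp.coeFn_smul c p.snd] with x hx
      rw [hx, Pi.smul_apply, real_inner_smul_left, mul_assoc]
    change ∫ x in Ω, (c • p.fst : L2 Ω) x * fderiv ℝ φ x v
      = - ∫ x in Ω, inner ℝ ((c • p.snd : L2Vec Ω) x) v * φ x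
    rw [h1, h2, hp φ hφ v, mul_neg]

/-- The function underlying an element of `H¹(Ω)`. -/
def fn {Ω : Set Plane} (u : H1 Ω) : L2 Ω := (u : WithLp 2 (L2 Ω × L2Vec Ω)).fst

/-- The weak gradient `∇u` of an element of `H¹(Ω)`. -/
def grad {Ω : Set Plane} (u : H1 Ω) : L2Vec Ω := (u : WithLp 2 (L2 Ω × L2Vec Ω)).snd

/-- The open unit disk `B₁(0) ⊂ ℝ²`. -/
abbrev disk : Set Plane := Metric.ball 0 1

/-- The unit circle `∂B₁(0)`. -/
abbrev circle : Set Plane := Metric.sphere 0 1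

/-- The arc-length measure `ds` on the unit circle. -/
abbrev arcLength : Measure circle := (volume : Measure Plane).toSphere

/-- `L²(∂B₁(0))`. -/
abbrev L2Bdry : Type := Lp ℝ 2 arcLength

/-- `g` is the boundary trace of `u ∈ H¹(B₁(0))`: there are functions `φ n` smooth up to the
boundary that converge to `u` in `H¹(B₁(0))` and whose restrictions to the circle converge to `g`
in `L²(∂B₁(0))`. -/
def IsTrace (u : H1 disk) (g : L2Bdry) : Prop :=
  ∃ φ : ℕ → Plane → ℝ, (∀ n, ContDiff ℝ ∞ (φ n)) ∧
    Tendsto (fun n => ∫ x in disk, (φ n x - fn u x) ^ 2) atTop (𝓝 0) ∧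
    Tendsto (fun n => ∫ x in disk, ‖gradient (φ n) x - grad u x‖ ^ 2) atTop (𝓝 0) ∧
    Tendsto (fun n => ∫ s : circle, (φ n s - g s) ^ 2 ∂arcLength) atTop (𝓝 0)

open Classical in
/-- The trace operator `H¹(B₁(0)) → L²(∂B₁(0))`. Every `u` has exactly one trace in the sense of
`IsTrace`, so the second branch is never taken. -/
def trace (u : H1 disk) : L2Bdry :=
  if h : ∃ g, IsTrace u g then h.choose else 0

/-- `u` is the (weak) solution of `-Δu = f` in `B₁(0)`, `u = 0` on `∂B₁(0)`: `u ∈ H¹₀` and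
`∫ ∇u · ∇v dx = ∫ f v dx` for all `v ∈ H¹₀`. -/
def IsDirichletSolution (f : Plane → ℝ) (u : H1 disk) : Prop :=
  trace u = 0 ∧ ∀ v : H1 disk, trace v = 0 →
    ∫ x in disk, inner ℝ (grad u x) (grad v x) = ∫ x in disk, f x * fn v x

/-- `u` is the (weak) solution of `-Δu = f` in `B₁(0)`, `∂ₙu + 2λu = 0` on `∂B₁(0)`: `u ∈ H¹` and
`∫ ∇u · ∇v dx + 2λ ∫_∂ u v ds = ∫ f v dx` for all `v ∈ H¹`. -/
def IsRobinSolution (lam : ℝ) (f : Plane → ℝ) (u : H1 disk) : Prop :=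
  ∀ v : H1 disk,
    (∫ x in disk, inner ℝ (grad u x) (grad v x))
      + 2 * lam * ∫ s, trace u s * trace v s ∂arcLength = ∫ x in disk, f x * fn v x

/-- The penalised energy `E_λ(u) = ½ ∫ |∇u|² dx - ∫ f u dx + λ ∫_∂ u² ds`. -/
def energy (lam : ℝ) (f : Plane → ℝ) (u : H1 disk) : ℝ :=
  1 / 2 * (∫ x in disk, ‖grad u x‖ ^ 2) - (∫ x in disk, f x * fn u x)
    + lam * ∫ s, trace u s ^ 2 ∂arcLength

/-- The loss `L_λ(θ) = E_λ(u_θ)` of a parametrised family `θ ↦ u_θ`. -/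
def loss {Θ : Type*} (lam : ℝ) (f : Plane → ℝ) (u : Θ → H1 disk) (θ : Θ) : ℝ :=
  energy lam f (u θ)

/-- The optimisation gap `δ_λ = L_λ(θ) - inf_{θ'} L_λ(θ')`. -/
def gap {Θ : Type*} (lam : ℝ) (f : Plane → ℝ) (u : Θ → H1 disk) (θ : Θ) : ℝ :=
  loss lam f u θ - ⨅ θ' : Θ, loss lam f u θ'

/-- `‖u‖_λ² = ‖∇u‖²_{L²(B₁(0))} + λ ‖u‖²_{L²(∂B₁(0))}`. -/
def lamNormSq (lam : ℝ) (u : H1 disk) : ℝ :=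
  (∫ x in disk, ‖grad u x‖ ^ 2) + lam * ∫ s, trace u s ^ 2 ∂arcLength

end DeepRitz

end

noncomputable section

namespace DeepRitz

/-! Both boundary value problems have explicit solutions: `u₀ = (1 - |x|²)/4`, and the Robin
solution is the same paraboloid plus the constant `1/(4λ)`. The two therefore differ by a constant
of `H¹` norm `√π/(4λ) ≤ π/(4λ)`, which is the last term of the bound (`norm_sub_le_of_solutions`).

For the distance from `u θ` to the Robin solution `uR`, the energy is quadratic and `uR` is its
critical point, so `E(v) - E(uR) = ½‖∇(v - uR)‖² + λ‖v - uR‖²_∂` exactly (`energy_eq`). At `v = u θ`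
this excess is the optimisation gap plus the infimum of the excesses over `Θ`, and the latter is at
most the best approximation error in `‖·‖_λ²`. A Friedrichs inequality `‖u‖² ≤ ‖∇u‖² + ‖u‖²_∂` turns
the excess into an `H¹` bound (`norm_sq_le_gap`).

Friedrichs, trace continuity and the weak equation of the paraboloid all come from the divergence
theorem for `φ x • x` with `φ` smooth. They extend to `H¹` because functions smooth up to the
boundary are dense (`exists_isSmoothPair_norm_sub_le`) and the trace graph is the closure of the
smooth one. -/

/-! ### Polar coordinates and the radial divergence theorem -/

theorem integral_disk_eq_integral_circle {F : Plane → ℝ} (hF : Continuous F) :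
    ∫ x in disk, F x = ∫ s : circle, ∫ r in Set.Ioo (0 : ℝ) 1, r * F (r • (s : Plane)) ∂volume
      ∂arcLength := by
  have hmp := (volume : Measure Plane).measurePreserving_homeomorphUnitSphereProd
  -- The radial measure has density `r ^ (dim - 1)`, here `r`.
  have hdim : Module.finrank ℝ Plane - 1 = 1 := by simp
  rw [hdim] at hmp
  have hmeas : MeasurableEmbedding (homeomorphUnitSphereProd Plane).symm :=
    Homeomorph.measurableEmbedding _
  have hmp' : MeasurePreserving (homeomorphUnitSphereProd Plane).symm
      (arcLength.prod (Measure.volumeIoiPow 1)) ((volume : Measure Plane).comap (↑)) :=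
    hmp.symm (homeomorphUnitSphereProd Plane).toMeasurableEquiv
  have hint : Integrable (disk.indicator F) (volume : Measure Plane) := by
    rw [integrable_indicator_iff measurableSet_ball]
    exact (hF.continuousOn.integrableOn_compact (isCompact_closedBall (0 : Plane) 1)).mono_set
      Metric.ball_subset_closedBall
  have hint' : Integrable (fun q => disk.indicator F ((homeomorphUnitSphereProd Plane).symm q))
      (arcLength.prod (Measure.volumeIoiPow 1)) := by
    refine (hmp'.integrable_comp_emb hmeas
      (g := fun y : ({0}ᶜ : Set Plane) => disk.indicator F y)).2 ?_
    have : IntegrableOn (disk.indicator F) ({0}ᶜ : Set Plane) := hint.integrableOn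
    exact (integrableOn_iff_comap_subtypeVal (measurableSet_singleton _).compl).1 this
  calc ∫ x in disk, F x = ∫ x, disk.indicator F x := (integral_indicator measurableSet_ball).symm
    _ = ∫ x : ({0}ᶜ : Set Plane), disk.indicator F x ∂((volume : Measure Plane).comap (↑)) := by
      rw [integral_subtype_comap (measurableSet_singleton _).compl (disk.indicator F),
        restrict_compl_singleton]
    _ = ∫ q, disk.indicator F ((homeomorphUnitSphereProd Plane).symm q)
          ∂(arcLength.prod (Measure.volumeIoiPow 1)) :=
      (hmp'.integral_comp hmeas (fun y : ({0}ᶜ : Set Plane) => disk.indicator F y)).symm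
    _ = _ := by
      rw [integral_prod _ hint']
      refine integral_congr_ae (.of_forall fun s => ?_)
      simp only [homeomorphUnitSphereProd_symm_apply_coe]
      simp only [Measure.volumeIoiPow, ENNReal.ofReal]
      rw [integral_withDensity_eq_integral_smul (by fun_prop),
        integral_subtype_comap measurableSet_Ioi
          (fun r : ℝ => Real.toNNReal (r ^ 1) • disk.indicator F (r • (s : Plane))),
        ← integral_indicator measurableSet_Ioi, ← integral_indicator measurableSet_Ioo]
      refine integral_congr_ae (.of_forall fun r => ?_)
      have hs : ‖(s : Plane)‖ = 1 := by simp
      by_cases h0 : 0 < r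
      · by_cases h1 : r < 1
        · have : r • (s : Plane) ∈ disk := by simp [norm_smul, hs, abs_of_pos h0, h1]
          simp [Set.indicator, h0, h1, this, NNReal.smul_def, h0.le]
        · have : r • (s : Plane) ∉ disk := by
            simpa [norm_smul, hs, abs_of_pos h0] using h1
          simp [Set.indicator, h0, h1, this]
      · simp [Set.indicator, h0]

/-- The divergence theorem for the vector field `x ↦ φ x • x` on the unit disk. -/
theorem integral_disk_radial_divergence {φ : Plane → ℝ} (hφ : ContDiff ℝ 1 φ) :
    ∫ x in disk, (2 * φ x + fderiv ℝ φ x x) = ∫ s : circle, φ s ∂arcLength := by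
  have hd : Continuous fun x => fderiv ℝ φ x x :=
    (hφ.continuous_fderiv one_ne_zero).clm_apply continuous_id
  rw [integral_disk_eq_integral_circle
    (F := fun x => 2 * φ x + fderiv ℝ φ x x) ((hφ.continuous.const_mul 2).add hd)]
  refine integral_congr_ae (.of_forall fun s => ?_)
  change ∫ r in Set.Ioo (0 : ℝ) 1, r * (2 * φ (r • (s : Plane)) +
    fderiv ℝ φ (r • (s : Plane)) (r • (s : Plane))) = φ s
  -- The radial integrand is the exact derivative of `r² φ(r s)`, which runs from `0` at the centre
  -- to `φ s` on the circle.
  have hder : ∀ r : ℝ, HasDerivAt (fun r : ℝ => r ^ 2 * φ (r • (s : Plane)))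
      (r * (2 * φ (r • (s : Plane)) + fderiv ℝ φ (r • (s : Plane)) (r • (s : Plane)))) r := by
    intro r
    have h1 : HasDerivAt (fun r : ℝ => r • (s : Plane)) ((1 : ℝ) • (s : Plane)) r :=
      (hasDerivAt_id r).smul_const _
    have h2 := ((hφ.differentiable one_ne_zero) (r • (s : Plane))).hasFDerivAt.comp_hasDerivAt r h1
    convert! (hasDerivAt_pow 2 r).mul h2 using 1
    simp
    ring
  have hcont : Continuous fun r : ℝ => r * (2 * φ (r • (s : Plane)) +
      fderiv ℝ φ (r • (s : Plane)) (r • (s : Plane))) := by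
    have hs : Continuous fun r : ℝ => r • (s : Plane) := by fun_prop
    exact continuous_id.mul (((hφ.continuous.comp hs).const_mul 2).add (hd.comp hs))
  rw [← integral_Ioc_eq_integral_Ioo, ← intervalIntegral.integral_of_le zero_le_one,
    intervalIntegral.integral_eq_sub_of_hasDerivAt (fun r _ => hder r)
      (hcont.intervalIntegrable _ _)]
  simp

/-! ### Functions smooth up to the boundary -/

theorem memLp_disk_of_continuous {E : Type*} [NormedAddCommGroup E] {F : Plane → E}
    (hF : Continuous F) : MemLp F 2 (volume.restrict disk) := by
  obtain ⟨C, hC⟩ := (isCompact_closedBall (0 : Plane) 1).exists_bound_of_continuousOn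
    hF.continuousOn
  have : IsFiniteMeasure (volume.restrict disk) := ⟨by simp⟩
  refine MemLp.of_bound hF.aestronglyMeasurable C ?_
  filter_upwards [ae_restrict_mem measurableSet_ball] with x hx
  exact hC x (Metric.ball_subset_closedBall hx)

theorem integrable_disk_of_continuous {F : Plane → ℝ} (hF : Continuous F) :
    IntegrableOn F disk :=
  (hF.continuousOn.integrableOn_compact (isCompact_closedBall (0 : Plane) 1)).mono_set
    Metric.ball_subset_closedBall

theorem continuous_gradient {φ : Plane → ℝ} (hφ : ContDiff ℝ ∞ φ) : Continuous (gradient φ) :=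
  (InnerProductSpace.toDual ℝ Plane).symm.continuous.comp (hφ.continuous_fderiv (by simp))

theorem inner_gradient (φ : Plane → ℝ) (x v : Plane) :
    inner ℝ (gradient φ x) v = fderiv ℝ φ x v := by
  simp [gradient]

/-- `φ` is smooth up to the boundary, and `u`, `g` are its restrictions to the open disk and to
the circle. -/
structure IsSmoothPair (φ : Plane → ℝ) (u : H1 disk) (g : L2Bdry) : Prop where
  smooth : ContDiff ℝ ∞ φ
  fn_ae : fn u =ᵐ[volume.restrict disk] φ
  grad_ae : grad u =ᵐ[volume.restrict disk] gradient φ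
  bdry_ae : g =ᵐ[arcLength] fun s => φ s

/-- The classical gradient is the weak one: the test function vanishes off the disk, so the
integration by parts can be done on the whole plane without boundary terms. -/
theorem exists_isSmoothPair {φ : Plane → ℝ} (hφ : ContDiff ℝ ∞ φ) :
    ∃ u g, IsSmoothPair φ u g := by
  have h1 : MemLp φ 2 (volume.restrict disk) := memLp_disk_of_continuous hφ.continuous
  have h2 : MemLp (gradient φ) 2 (volume.restrict disk) :=
    memLp_disk_of_continuous (continuous_gradient hφ)
  have h3 : MemLp (fun s : circle => φ s) 2 arcLength := by
    have hc : Continuous fun s : circle => φ s := hφ.continuous.comp continuous_subtype_val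
    obtain ⟨C, hC⟩ := isCompact_univ.exists_bound_of_continuousOn hc.continuousOn
    exact MemLp.of_bound hc.aestronglyMeasurable C (.of_forall fun s => hC s trivial)
  refine ⟨⟨WithLp.toLp 2 (h1.toLp φ, h2.toLp (gradient φ)), ?_⟩, h3.toLp _, hφ, h1.coeFn_toLp,
    h2.coeFn_toLp, h3.coeFn_toLp⟩
  intro ψ hψ v
  have e1 : ∫ x in disk, (h1.toLp φ) x * fderiv ℝ ψ x v = ∫ x, φ x * fderiv ℝ ψ x v := by
    refine Eq.trans ?_ (setIntegral_eq_integral_of_forall_compl_eq_zero (s := disk) ?_)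
    · refine integral_congr_ae ?_
      filter_upwards [h1.coeFn_toLp] with x hx
      rw [hx]
    · intro x hx
      have : x ∉ tsupport (fderiv ℝ ψ) :=
        fun h => hx (hψ.support (tsupport_fderiv_subset ℝ h))
      rw [image_eq_zero_of_notMem_tsupport this]; simp
  have e2 : ∫ x in disk, inner ℝ ((h2.toLp (gradient φ)) x) v * ψ x
      = ∫ x, fderiv ℝ φ x v * ψ x := by
    refine Eq.trans ?_ (setIntegral_eq_integral_of_forall_compl_eq_zero (s := disk) ?_)
    · refine integral_congr_ae ?_
      filter_upwards [h2.coeFn_toLp] with x hx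
      rw [hx, inner_gradient]
    · intro x hx
      rw [image_eq_zero_of_notMem_tsupport fun h => hx (hψ.support h), mul_zero]
  change ∫ x in disk, (h1.toLp φ) x * fderiv ℝ ψ x v
    = - ∫ x in disk, inner ℝ ((h2.toLp (gradient φ)) x) v * ψ x
  have c1 : Continuous fun x => fderiv ℝ φ x v :=
    (hφ.continuous_fderiv (by simp)).clm_apply continuous_const
  have c2 : Continuous fun x => fderiv ℝ ψ x v :=
    (hψ.smooth.continuous_fderiv (by simp)).clm_apply continuous_const
  rw [e1, e2]
  refine integral_mul_fderiv_eq_neg_fderiv_mul_of_integrable ?_ ?_ ?_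
    (fun x _ => hφ.differentiable (by simp) x) (fun x _ => hψ.smooth.differentiable (by simp) x)
  · exact (c1.mul hψ.smooth.continuous).integrable_of_hasCompactSupport hψ.compact.mul_left
  · exact (hφ.continuous.mul c2).integrable_of_hasCompactSupport
      (hψ.compact.fderiv_apply (𝕜 := ℝ) v).mul_left
  · exact (hφ.continuous.mul hψ.smooth.continuous).integrable_of_hasCompactSupport
      hψ.compact.mul_left

theorem norm_sq_eq_integral {α E : Type*} [MeasurableSpace α] {μ : Measure α}
    [NormedAddCommGroup E] [InnerProductSpace ℝ E] (f : Lp E 2 μ) :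
    ‖f‖ ^ 2 = ∫ x, ‖f x‖ ^ 2 ∂μ := by
  rw [← real_inner_self_eq_norm_sq, L2.inner_def]
  simp only [real_inner_self_eq_norm_sq]

theorem norm_sq_eq_integral_sq {α : Type*} [MeasurableSpace α] {μ : Measure α}
    (f : Lp ℝ 2 μ) : ‖f‖ ^ 2 = ∫ x, f x ^ 2 ∂μ := by
  rw [norm_sq_eq_integral]
  simp only [Real.norm_eq_abs, sq_abs]

theorem H1_norm_sq (u : H1 disk) : ‖u‖ ^ 2 = ‖fn u‖ ^ 2 + ‖grad u‖ ^ 2 :=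
  WithLp.prod_norm_sq_eq_of_L2 (u : WithLp 2 (L2 disk × L2Vec disk))

theorem continuous_fn : Continuous (fn : H1 disk → L2 disk) :=
  (WithLp.prod_continuous_ofLp 2 _ _).fst.comp continuous_subtype_val

theorem continuous_grad : Continuous (grad : H1 disk → L2Vec disk) :=
  (WithLp.prod_continuous_ofLp 2 _ _).snd.comp continuous_subtype_val

namespace IsSmoothPair

variable {φ : Plane → ℝ} {u : H1 disk} {g : L2Bdry}

theorem norm_fn_sq (h : IsSmoothPair φ u g) : ‖fn u‖ ^ 2 = ∫ x in disk, φ x ^ 2 := by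
  rw [norm_sq_eq_integral_sq]
  refine integral_congr_ae ?_
  filter_upwards [h.fn_ae] with x hx
  rw [hx]

theorem norm_grad_sq (h : IsSmoothPair φ u g) :
    ‖grad u‖ ^ 2 = ∫ x in disk, ‖gradient φ x‖ ^ 2 := by
  rw [norm_sq_eq_integral]
  refine integral_congr_ae ?_
  filter_upwards [h.grad_ae] with x hx
  rw [hx]

/-- Radial divergence theorem applied to `φ²`. -/
theorem norm_bdry_sq (h : IsSmoothPair φ u g) :
    ‖g‖ ^ 2 = ∫ x in disk, (2 * φ x ^ 2 + 2 * φ x * fderiv ℝ φ x x) := by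
  have e := integral_disk_radial_divergence (φ := fun x => φ x ^ 2)
    ((h.smooth.pow 2).of_le (by exact_mod_cast le_top))
  have e' : ‖g‖ ^ 2 = ∫ s : circle, φ s ^ 2 ∂arcLength := by
    rw [norm_sq_eq_integral_sq]
    refine integral_congr_ae ?_
    filter_upwards [h.bdry_ae] with x hx
    rw [hx]
  rw [e', ← e]
  congr 1
  ext x
  have hd : HasFDerivAt φ (fderiv ℝ φ x) x := (h.smooth.differentiable (by simp) x).hasFDerivAt
  rw [(hd.pow 2).fderiv]
  simp

theorem two_mul_abs_le {x : Plane} (hx : x ∈ disk) :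
    |2 * φ x * fderiv ℝ φ x x| ≤ φ x ^ 2 + ‖gradient φ x‖ ^ 2 := by
  have h1 : |fderiv ℝ φ x x| ≤ ‖gradient φ x‖ := by
    rw [← inner_gradient]
    refine (abs_real_inner_le_norm _ _).trans ?_
    have : ‖x‖ ≤ 1 := by simpa using (Metric.ball_subset_closedBall hx)
    exact mul_le_of_le_one_right (norm_nonneg _) this
  rw [abs_mul, abs_mul, abs_two]
  nlinarith [sq_nonneg (|φ x| - ‖gradient φ x‖), abs_nonneg (φ x), sq_abs (φ x)]

theorem integrable_terms (h : IsSmoothPair φ u g) :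
    IntegrableOn (fun x => φ x ^ 2) disk ∧ IntegrableOn (fun x => ‖gradient φ x‖ ^ 2) disk ∧
      IntegrableOn (fun x => 2 * φ x ^ 2 + 2 * φ x * fderiv ℝ φ x x) disk := by
  have hc := h.smooth.continuous
  have hd : Continuous fun x => fderiv ℝ φ x x :=
    (h.smooth.continuous_fderiv (by simp)).clm_apply continuous_id
  exact ⟨integrable_disk_of_continuous (hc.pow 2),
    integrable_disk_of_continuous ((continuous_gradient h.smooth).norm.pow 2),
    integrable_disk_of_continuous (((hc.pow 2).const_mul 2).add ((hc.const_mul 2).mul hd))⟩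

/-- Holds pointwise under the integral: `2 φ ∂ₓφ ≥ -φ² - |∇φ|²` on the disk, and the `2 φ²` in the
boundary identity leaves one `φ²` over. -/
theorem friedrichs (h : IsSmoothPair φ u g) : ‖fn u‖ ^ 2 ≤ ‖grad u‖ ^ 2 + ‖g‖ ^ 2 := by
  obtain ⟨i1, i2, i3⟩ := h.integrable_terms
  rw [h.norm_fn_sq, h.norm_grad_sq, h.norm_bdry_sq, ← integral_add i2 i3]
  refine setIntegral_mono_on i1 (i2.add i3) measurableSet_ball fun x hx => ?_
  have := abs_le.1 (two_mul_abs_le (φ := φ) hx)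
  linarith [this.1]

theorem norm_bdry_sq_le (h : IsSmoothPair φ u g) :
    ‖g‖ ^ 2 ≤ 3 * ‖fn u‖ ^ 2 + ‖grad u‖ ^ 2 := by
  obtain ⟨i1, i2, i3⟩ := h.integrable_terms
  rw [h.norm_fn_sq, h.norm_grad_sq, h.norm_bdry_sq, ← integral_const_mul,
    ← integral_add (i1.const_mul 3) i2]
  refine setIntegral_mono_on i3 ((i1.const_mul 3).add i2) measurableSet_ball fun x hx => ?_
  have := abs_le.1 (two_mul_abs_le (φ := φ) hx)
  linarith [this.2]

/-- The field `-x/2` is the gradient of `parabola`, so this is the weak equation of the paraboloid,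
tested against smooth functions that need not vanish on the circle. -/
theorem green (h : IsSmoothPair φ u g) :
    ∫ x in disk, inner ℝ (-(1 / 2 : ℝ) • x) (grad u x)
      = (∫ x in disk, fn u x) - 1 / 2 * ∫ s, g s ∂arcLength := by
  have hc := h.smooth.continuous
  have hd : Continuous fun x => fderiv ℝ φ x x :=
    (h.smooth.continuous_fderiv (by simp)).clm_apply continuous_id
  have e1 : ∫ x in disk, inner ℝ (-(1 / 2 : ℝ) • x) (grad u x)
      = -(1 / 2) * ∫ x in disk, fderiv ℝ φ x x := by
    rw [← integral_const_mul]
    refine integral_congr_ae ?_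
    filter_upwards [h.grad_ae] with x hx
    rw [hx, real_inner_smul_left, real_inner_comm, inner_gradient]
  rw [e1, integral_congr_ae h.fn_ae, integral_congr_ae h.bdry_ae,
    ← integral_disk_radial_divergence (h.smooth.of_le (by exact_mod_cast le_top)),
    integral_add (integrable_disk_of_continuous (hc.const_mul 2))
      (integrable_disk_of_continuous hd), integral_const_mul]
  ring

theorem zero : IsSmoothPair 0 0 0 where
  smooth := contDiff_const
  fn_ae := Lp.coeFn_zero ℝ 2 _
  grad_ae := by
    have : gradient (0 : Plane → ℝ) = 0 := by ext1 x; exact gradient_const x 0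
    rw [this]
    exact Lp.coeFn_zero Plane 2 _
  bdry_ae := Lp.coeFn_zero ℝ 2 _

theorem add {ψ : Plane → ℝ} {v : H1 disk} {k : L2Bdry} (h : IsSmoothPair φ u g)
    (h' : IsSmoothPair ψ v k) : IsSmoothPair (φ + ψ) (u + v) (g + k) where
  smooth := h.smooth.add h'.smooth
  fn_ae := (Lp.coeFn_add (fn u) (fn v)).trans (h.fn_ae.add h'.fn_ae)
  grad_ae := by
    have : gradient (φ + ψ) = gradient φ + gradient ψ := by
      ext1 x
      simp only [gradient, Pi.add_apply]
      rw [fderiv_add (h.smooth.differentiable (by simp) x) (h'.smooth.differentiable (by simp) x),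
        map_add]
    rw [this]
    exact (Lp.coeFn_add (grad u) (grad v)).trans (h.grad_ae.add h'.grad_ae)
  bdry_ae := (Lp.coeFn_add g k).trans (h.bdry_ae.add h'.bdry_ae)

theorem smul (c : ℝ) (h : IsSmoothPair φ u g) : IsSmoothPair (c • φ) (c • u) (c • g) where
  smooth := h.smooth.const_smul c
  fn_ae := (Lp.coeFn_smul c (fn u)).trans (h.fn_ae.const_smul c)
  grad_ae := by
    have : gradient (c • φ) = c • gradient φ := by
      ext1 x
      simp only [gradient, Pi.smul_apply]
      rw [fderiv_const_smul (h.smooth.differentiable (by simp) x), map_smul]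
    rw [this]
    exact (Lp.coeFn_smul c (grad u)).trans (h.grad_ae.const_smul c)
  bdry_ae := (Lp.coeFn_smul c g).trans (h.bdry_ae.const_smul c)

end IsSmoothPair

/-- The graph of the restriction map from functions smooth up to the boundary to `L²(∂B₁(0))`. -/
def smoothTraceGraph : Submodule ℝ (H1 disk × L2Bdry) where
  carrier := {q | ∃ φ, IsSmoothPair φ q.1 q.2}
  zero_mem' := ⟨0, .zero⟩
  add_mem' := fun ⟨_, h⟩ ⟨_, h'⟩ => ⟨_, h.add h'⟩
  smul_mem' := fun c _ ⟨_, h⟩ => ⟨_, h.smul c⟩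

/-! ### Contraction and mollification in `L²` -/

section Smoothing

open ContinuousLinearMap
open scoped Convolution

variable {E : Type*} [NormedAddCommGroup E]

/-- The dilation scales Lebesgue measure by `r⁻² ≤ 4`. The sharp factor for the norm would be `r⁻¹ ≤
2`; the cruder `4` suffices. -/
theorem eLpNorm_comp_smul_le {r : ℝ} (hr : 1 / 2 ≤ r) {h : Plane → E}
    (hh : StronglyMeasurable h) :
    eLpNorm (fun x => h (r • x)) 2 volume ≤ 4 * eLpNorm h 2 volume := by
  have hr0 : 0 < r := by linarith
  have e := eLpNorm_map_measure (p := 2) (μ := (volume : Measure Plane))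
    (f := fun x : Plane => r • x) (g := h) hh.aestronglyMeasurable
    (measurable_const_smul r).aemeasurable
  change eLpNorm (h ∘ fun x => r • x) 2 volume ≤ _
  rw [← e, Measure.map_addHaar_smul _ hr0.ne', eLpNorm_smul_measure_of_ne_top (by simp),
    smul_eq_mul]
  gcongr
  have h4 : ENNReal.ofReal |(r ^ Module.finrank ℝ Plane)⁻¹| ≤ 4 := by
    have : |(r ^ Module.finrank ℝ Plane)⁻¹| ≤ 4 := by
      rw [finrank_euclideanSpace_fin, abs_of_pos (by positivity)]
      refine inv_le_of_inv_le₀ (by norm_num) ?_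
      nlinarith
    exact (ENNReal.ofReal_le_ofReal this).trans_eq (by simp)
  calc ENNReal.ofReal |(r ^ Module.finrank ℝ Plane)⁻¹| ^ (1 / 2 : ENNReal).toReal
      ≤ 4 ^ (1 / 2 : ENNReal).toReal := by gcongr
    _ ≤ 4 ^ (1 : ℝ) := by
      refine ENNReal.rpow_le_rpow_of_exponent_le (by norm_num) ?_
      simp
      norm_num
    _ = 4 := by simp

theorem memLp_comp_smul {r : ℝ} (hr : 1 / 2 ≤ r) {h : Plane → E}
    (hh : StronglyMeasurable h) (hL : MemLp h 2 volume) :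
    MemLp (fun x => h (r • x)) 2 volume :=
  ⟨(hh.comp_measurable (measurable_const_smul r)).aestronglyMeasurable,
    (eLpNorm_comp_smul_le hr hh).trans_lt (ENNReal.mul_lt_top (by simp) hL.2)⟩

variable [NormedSpace ℝ E]

/-- The contraction in `L²` given by convolution with a probability density. -/
theorem eLpNorm_convolution_le {η : Plane → ℝ} (hη : Continuous η) (h0 : ∀ x, 0 ≤ η x)
    (h1 : ∫ x, η x = 1) {h : Plane → E} (hh : StronglyMeasurable h) :
    eLpNorm (η ⋆[lsmul ℝ ℝ, volume] h) 2 volume ≤ eLpNorm h 2 volume := by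
  set ν : Measure Plane := volume.withDensity fun t => ‖η t‖ₑ with hν
  have hi : Integrable η := by
    by_contra hc
    rw [integral_undef hc] at h1
    exact zero_ne_one h1
  have hprob : IsProbabilityMeasure ν := by
    constructor
    rw [hν, withDensity_apply _ MeasurableSet.univ, Measure.restrict_univ]
    have e : ∀ t, ‖η t‖ₑ = ENNReal.ofReal (η t) := fun t => Real.enorm_of_nonneg (h0 t)
    simp_rw [e]
    rw [← ofReal_integral_eq_lintegral_ofReal hi (.of_forall h0), h1, ENNReal.ofReal_one]
  -- Jensen's inequality for the probability measure `ν = η dt`, in the form that the `L¹(ν)` norm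
  -- is at most the `L²(ν)` norm. Tonelli and translation invariance then finish.
  have key : ∀ x, ‖(η ⋆[lsmul ℝ ℝ, volume] h) x‖ₑ ^ 2 ≤ ∫⁻ t, ‖h (x - t)‖ₑ ^ 2 ∂ν := by
    intro x
    have hm : StronglyMeasurable fun t => h (x - t) :=
      hh.comp_measurable (measurable_const.sub measurable_id)
    have e1 : ‖(η ⋆[lsmul ℝ ℝ, volume] h) x‖ₑ ≤ eLpNorm (fun t => h (x - t)) 1 ν := by
      rw [eLpNorm_one_eq_lintegral_enorm, hν,
        lintegral_withDensity_eq_lintegral_mul _ hη.measurable.enorm hm.enorm]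
      refine (enorm_integral_le_lintegral_enorm _).trans_eq ?_
      refine lintegral_congr fun t => ?_
      simp [enorm_smul]
    have e2 := eLpNorm_nnreal_pow_eq_lintegral (f := fun t => h (x - t)) (μ := ν) two_ne_zero
    simp only [NNReal.coe_ofNat, ENNReal.rpow_ofNat, ENNReal.coe_ofNat] at e2
    rw [← e2]
    gcongr
    exact e1.trans (eLpNorm_le_eLpNorm_of_exponent_le one_le_two hm.aestronglyMeasurable)
  have e1 := eLpNorm_nnreal_pow_eq_lintegral (f := η ⋆[lsmul ℝ ℝ, volume] h)
    (μ := (volume : Measure Plane)) two_ne_zero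
  have e2 := eLpNorm_nnreal_pow_eq_lintegral (f := h)
    (μ := (volume : Measure Plane)) two_ne_zero
  simp only [NNReal.coe_ofNat, ENNReal.rpow_ofNat, ENNReal.coe_ofNat] at e1 e2
  refine (ENNReal.pow_le_pow_left_iff two_ne_zero).1 ?_
  rw [e1, e2]
  calc ∫⁻ x, ‖(η ⋆[lsmul ℝ ℝ, volume] h) x‖ₑ ^ 2
      ≤ ∫⁻ x, ∫⁻ t, ‖h (x - t)‖ₑ ^ 2 ∂ν := lintegral_mono key
    _ = ∫⁻ t, (∫⁻ x, ‖h (x - t)‖ₑ ^ 2) ∂ν := by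
      refine lintegral_lintegral_swap ?_
      exact ((hh.comp_measurable (measurable_fst.sub measurable_snd)).enorm.pow_const 2).aemeasurable
    _ = ∫⁻ _, (∫⁻ x, ‖h x‖ₑ ^ 2) ∂ν := by
      refine lintegral_congr fun t => ?_
      exact lintegral_sub_right_eq_self (fun x => ‖h x‖ₑ ^ 2) t
    _ = ∫⁻ x, ‖h x‖ₑ ^ 2 := by simp

/-- Contraction towards the origin followed by mollification. -/
def smoothing (b : ContDiffBump (0 : Plane)) (f : Plane → E) : Plane → E :=
  b.normed volume ⋆[lsmul ℝ ℝ, volume] fun x => f ((1 - b.rOut) • x)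

theorem convolutionExists_smoothing (b : ContDiffBump (0 : Plane)) (hb : b.rOut ≤ 1 / 2)
    {h : Plane → E} (hh : StronglyMeasurable h) (hL : MemLp h 2 volume) :
    ConvolutionExists (b.normed volume) (fun x => h ((1 - b.rOut) • x)) (lsmul ℝ ℝ) volume :=
  b.hasCompactSupport_normed.convolutionExists_left _ (b.contDiff_normed (n := 0)).continuous
    ((memLp_comp_smul (by linarith) hh hL).locallyIntegrable one_le_two)

theorem continuous_smoothing (b : ContDiffBump (0 : Plane)) (hb : b.rOut ≤ 1 / 2)
    {h : Plane → E} (hh : StronglyMeasurable h) (hL : MemLp h 2 volume) :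
    Continuous (smoothing b h) :=
  b.hasCompactSupport_normed.continuous_convolution_left _
    (b.contDiff_normed (n := 0)).continuous
    ((memLp_comp_smul (by linarith) hh hL).locallyIntegrable one_le_two)

theorem eLpNorm_smoothing_le (b : ContDiffBump (0 : Plane)) (hb : b.rOut ≤ 1 / 2)
    {h : Plane → E} (hh : StronglyMeasurable h) :
    eLpNorm (smoothing b h) 2 volume ≤ 4 * eLpNorm h 2 volume :=
  (eLpNorm_convolution_le (b.contDiff_normed (n := 0)).continuous b.nonneg_normed
    b.integral_normed (hh.comp_measurable (measurable_const_smul _))).trans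
    (eLpNorm_comp_smul_le (by linarith) hh)

variable [CompleteSpace E]

theorem exists_forall_norm_smoothing_sub_le {g : Plane → E} (hg : Continuous g)
    (hgc : HasCompactSupport g) {κ : ℝ} (hκ : 0 < κ) :
    ∃ ε > 0, ∀ b : ContDiffBump (0 : Plane), b.rOut ≤ ε → ∀ x ∈ disk,
      ‖smoothing b g x - g x‖ ≤ κ := by
  obtain ⟨δ, hδ, hu⟩ := Metric.uniformContinuous_iff.1
    (hgc.uniformContinuous_of_continuous hg) κ hκ
  refine ⟨min (δ / 3) 1, by positivity, fun b hb x hx => ?_⟩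
  have hb1 : b.rOut ≤ δ / 3 := hb.trans (min_le_left _ _)
  have hb2 : b.rOut ≤ 1 := hb.trans (min_le_right _ _)
  have hb0 := b.rOut_pos
  rw [← dist_eq_norm]
  refine dist_convolution_le hκ.le b.support_normed_eq.subset b.nonneg_normed b.integral_normed
    (hg.comp (continuous_const_smul _)).aestronglyMeasurable fun y hy => (hu ?_).le
  have hx' : ‖x‖ < 1 := by simpa using hx
  have hy' : ‖y - x‖ < b.rOut := by simpa [dist_eq_norm] using hy
  rw [dist_eq_norm]
  -- The displacement is below `2 * b.rOut`, hence below `δ`, for `x` in the disk.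
  have e : (1 - b.rOut) • y - x = (1 - b.rOut) • (y - x) - b.rOut • x := by module
  rw [e]
  refine (norm_sub_le _ _).trans_lt ?_
  rw [norm_smul, norm_smul, Real.norm_of_nonneg (by linarith), Real.norm_of_nonneg hb0.le]
  nlinarith [norm_nonneg x, norm_nonneg (y - x)]

/-- Three-term argument: replace `f` by a continuous compactly supported `g`, on which smoothing
converges uniformly. The operator bound `4` and `√π ≤ 4` for the disk give `4/10 + 4/20 + 1/10 < 1`
times `κ`. -/
theorem exists_forall_eLpNorm_smoothing_sub_le {f : Plane → E} (hf : StronglyMeasurable f)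
    (hL : MemLp f 2 volume) {κ : NNReal} (hκ : 0 < κ) :
    ∃ ε > 0, ∀ b : ContDiffBump (0 : Plane), b.rOut ≤ ε →
      eLpNorm (smoothing b f - f) 2 (volume.restrict disk) ≤ κ := by
  obtain ⟨g, hgc, hfg, hg, hgL⟩ := hL.exists_hasCompactSupport_eLpNorm_sub_le (by simp)
    (ε := ((κ / 10 : NNReal) : ENNReal)) (by simpa using hκ.ne')
  obtain ⟨ε, hε, hb⟩ := exists_forall_norm_smoothing_sub_le hg hgc
    (κ := κ / 20) (by positivity)
  refine ⟨min ε (1 / 2), by positivity, fun b hbr => ?_⟩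
  have hb1 : b.rOut ≤ ε := hbr.trans (min_le_left _ _)
  have hb2 : b.rOut ≤ 1 / 2 := hbr.trans (min_le_right _ _)
  have hgm : StronglyMeasurable g := hg.stronglyMeasurable_of_hasCompactSupport hgc
  have hsub : smoothing b (f - g) = smoothing b f - smoothing b g := by
    ext1 x
    have hd := integral_sub (convolutionExists_smoothing b hb2 hf hL x)
      (convolutionExists_smoothing b hb2 hgm hgL x)
    simp only [← map_sub] at hd
    exact hd
  have e : smoothing b f - f = smoothing b (f - g) + (smoothing b g - g) + (g - f) := by
    rw [hsub]; abel
  have m1 := (continuous_smoothing b hb2 (hf.sub hgm) (hL.sub hgL)).aestronglyMeasurable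
    (μ := volume.restrict disk)
  have m2 := (continuous_smoothing b hb2 hgm hgL).aestronglyMeasurable
    (μ := volume.restrict disk)
  have n1 : eLpNorm (smoothing b (f - g)) 2 (volume.restrict disk) ≤ 4 * (κ / 10 : NNReal) := by
    refine (eLpNorm_mono_measure _ Measure.restrict_le_self).trans
      ((eLpNorm_smoothing_le b hb2 (hf.sub hgm)).trans ?_)
    gcongr
  have n3 : eLpNorm (g - f) 2 (volume.restrict disk) ≤ (κ / 10 : NNReal) := by
    rw [eLpNorm_sub_comm]
    exact (eLpNorm_mono_measure _ Measure.restrict_le_self).trans hfg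
  have n2 : eLpNorm (smoothing b g - g) 2 (volume.restrict disk) ≤ 4 * (κ / 20 : NNReal) := by
    refine (eLpNorm_le_of_ae_bound (C := κ / 20) ?_).trans ?_
    · filter_upwards [ae_restrict_mem measurableSet_ball] with x hx
      exact hb b hb1 x hx
    · have hv : (volume.restrict disk) Set.univ ≤ (4 : ENNReal) := by
        rw [Measure.restrict_apply_univ, EuclideanSpace.volume_ball_fin_two]
        simpa using Real.pi_le_four
      have hk : ENNReal.ofReal (κ / 20 : ℝ) = ((κ / 20 : NNReal) : ENNReal) := by
        rw [← ENNReal.ofReal_coe_nnreal]; simp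
      rw [hk]
      gcongr
      calc (volume.restrict disk) Set.univ ^ (2 : ENNReal).toReal⁻¹
          ≤ 4 ^ (2 : ENNReal).toReal⁻¹ := by gcongr
        _ ≤ 4 ^ (1 : ℝ) := by
          refine ENNReal.rpow_le_rpow_of_exponent_le (by norm_num) ?_
          simp
          norm_num
        _ = 4 := by simp
  rw [e]
  refine (eLpNorm_add_le (m1.add (m2.sub hgm.aestronglyMeasurable))
    (hgm.sub hf).aestronglyMeasurable one_le_two).trans ?_
  refine (add_le_add (eLpNorm_add_le m1 (m2.sub hgm.aestronglyMeasurable) one_le_two)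
    le_rfl).trans ?_
  refine (add_le_add (add_le_add n1 n2) n3).trans ?_
  norm_cast
  rw [← NNReal.coe_le_coe]
  push_cast
  have : (0 : ℝ) < κ := hκ
  linarith

end Smoothing

/-! ### Density of smooth functions in `H¹` -/

section Density

open ContinuousLinearMap
open scoped Convolution

theorem stronglyMeasurable_indicator_disk {E : Type*} [NormedAddCommGroup E]
    (f : Lp E 2 (volume.restrict disk)) : StronglyMeasurable (disk.indicator f) :=
  (Lp.stronglyMeasurable f).indicator measurableSet_ball

theorem memLp_indicator_disk {E : Type*} [NormedAddCommGroup E]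
    (f : Lp E 2 (volume.restrict disk)) : MemLp (disk.indicator f) 2 volume :=
  (memLp_indicator_iff_restrict measurableSet_ball).2 (Lp.memLp f)

theorem integral_smul_indicator_comp_smul {E : Type*} [NormedAddCommGroup E] [NormedSpace ℝ E]
    (r : ℝ) (hr : 0 < r) (ψ : Plane → ℝ) (f : Plane → E) :
    ∫ y, ψ y • disk.indicator f (r • y)
      = (r ^ 2)⁻¹ • ∫ z in disk, ψ (r⁻¹ • z) • f z := by
  have e := Measure.integral_comp_smul (volume : Measure Plane)
    (fun z => ψ (r⁻¹ • z) • disk.indicator f z) r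
  rw [finrank_euclideanSpace_fin, abs_of_pos (by positivity)] at e
  simp only [inv_smul_smul₀ hr.ne'] at e
  rw [e, ← integral_indicator measurableSet_ball]
  congr 2
  ext z
  by_cases hz : z ∈ disk <;> simp [Set.indicator, hz]

/-- The contraction factor is tied to the mollification radius `ρ` so that the support lies within
radius `(1 - ρ)(1 + ρ) < 1`. The kernel is thus admissible in the definition of the weak gradient,
and the jump of the zero extension across the circle is never seen. -/
theorem isTestFunction_rescaled_bump (b : ContDiffBump (0 : Plane)) (hb : b.rOut ≤ 1 / 2)
    {x : Plane} (hx : x ∈ disk) :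
    IsTestFunction disk fun z => b.normed volume (x - (1 - b.rOut)⁻¹ • z) := by
  have hb0 := b.rOut_pos
  have hr : 0 < 1 - b.rOut := by linarith
  have hsub : tsupport (fun z => b.normed volume (x - (1 - b.rOut)⁻¹ • z)) ⊆
      Metric.closedBall 0 ((1 - b.rOut) * (1 + b.rOut)) := by
    refine closure_minimal (fun z hz => ?_) Metric.isClosed_closedBall
    have hz' : x - (1 - b.rOut)⁻¹ • z ∈ Function.support (b.normed volume) := hz
    rw [b.support_normed_eq, mem_ball_zero_iff] at hz'
    have hx' : ‖x‖ < 1 := by simpa using hx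
    have e : z = (1 - b.rOut) • (x - (x - (1 - b.rOut)⁻¹ • z)) := by
      rw [sub_sub_cancel, smul_inv_smul₀ hr.ne']
    rw [mem_closedBall_zero_iff, e, norm_smul, Real.norm_of_nonneg hr.le]
    gcongr
    exact (norm_sub_le _ _).trans (by linarith)
  refine ⟨(b.contDiff_normed (n := ⊤)).comp (contDiff_const.sub (contDiff_const_smul _)), ?_, ?_⟩
  · exact (isCompact_closedBall _ _).of_isClosed_subset (isClosed_tsupport _) hsub
  · refine hsub.trans (Metric.closedBall_subset_ball ?_)
    nlinarith

/-- The derivative falls on the kernel; after rescaling, the weak gradient identity tested with the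
rescaled bump moves it onto `u`. The factor `1 - b.rOut` is the chain rule for the contraction. -/
theorem fderiv_smoothing_apply (u : H1 disk) (b : ContDiffBump (0 : Plane)) (hb : b.rOut ≤ 1 / 2)
    {x : Plane} (hx : x ∈ disk) (v : Plane) :
    fderiv ℝ (smoothing b (disk.indicator (fn u))) x v
      = (1 - b.rOut) * inner ℝ (smoothing b (disk.indicator (grad u)) x) v := by
  set r : ℝ := 1 - b.rOut with hr
  have hr0 : 0 < r := by linarith
  have hψ := isTestFunction_rescaled_bump b hb hx
  have hηs : ContDiff ℝ 1 (b.normed volume : Plane → ℝ) := b.contDiff_normed (n := 1)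
  have hηc : HasCompactSupport (b.normed volume : Plane → ℝ) := b.hasCompactSupport_normed
  have hloc : LocallyIntegrable (fun y => disk.indicator (fn u) (r • y)) volume :=
    (memLp_comp_smul (by linarith) (stronglyMeasurable_indicator_disk _)
      (memLp_indicator_disk _)).locallyIntegrable one_le_two
  have hd := hηc.hasFDerivAt_convolution_left (lsmul ℝ ℝ) (μ := volume) hηs hloc x
  have hint := ((hηc.fderiv (𝕜 := ℝ)).convolutionExists_left ((lsmul ℝ ℝ).precompL Plane)
    (hηs.continuous_fderiv one_ne_zero) hloc x).integrable_swap
  have e1 : fderiv ℝ (smoothing b (disk.indicator (fn u))) x v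
      = ∫ y, fderiv ℝ (b.normed volume) (x - y) v • disk.indicator (fn u) (r • y) := by
    have : fderiv ℝ (smoothing b (disk.indicator (fn u))) x = _ := hd.fderiv
    rw [this, convolution_eq_swap, ContinuousLinearMap.integral_apply hint]
    simp
  have e2 : inner ℝ (smoothing b (disk.indicator (grad u)) x) v
      = (r ^ 2)⁻¹ * ∫ z in disk, inner ℝ (grad u z) v * b.normed volume (x - r⁻¹ • z) := by
    have hi : Integrable fun y => b.normed volume (x - y) • disk.indicator (grad u) (r • y) :=
      (convolutionExists_smoothing b hb (stronglyMeasurable_indicator_disk (grad u))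
        (memLp_indicator_disk _) x).integrable_swap
    have : smoothing b (disk.indicator (grad u)) x
        = ∫ y, b.normed volume (x - y) • disk.indicator (grad u) (r • y) :=
      convolution_eq_swap _
    have hi2 : Integrable (fun z => b.normed volume (x - r⁻¹ • z) • grad u z)
        (volume.restrict disk) := by
      refine (memLp_one_iff_integrable.1 ?_)
      exact (Lp.memLp (grad u)).smul (p := 2) (q := 2) (r := 1) hψ.memLp
    rw [this, integral_smul_indicator_comp_smul r hr0 (fun y => b.normed volume (x - y)),
      real_inner_smul_left, real_inner_comm, ← integral_inner hi2]
    congr 1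
    refine integral_congr_ae (.of_forall fun z => ?_)
    simp only [real_inner_smul_right, real_inner_comm v]
    ring
  have e3 : ∀ z, fderiv ℝ (fun z => b.normed volume (x - r⁻¹ • z)) z v
      = - r⁻¹ * fderiv ℝ (b.normed volume) (x - r⁻¹ • z) v := by
    intro z
    have h1 : HasFDerivAt (fun z : Plane => x - r⁻¹ • z) (-(r⁻¹ • ContinuousLinearMap.id ℝ Plane)) z :=
      ((hasFDerivAt_id z).const_smul r⁻¹).const_sub x
    have h2 := ((hηs.differentiable one_ne_zero) (x - r⁻¹ • z)).hasFDerivAt.comp z h1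
    have h3 : fderiv ℝ (fun z => b.normed volume (x - r⁻¹ • z)) z = _ := h2.fderiv
    rw [h3]
    simp
  have hw : ∫ z in disk, fn u z * fderiv ℝ (fun z => b.normed volume (x - r⁻¹ • z)) z v
      = - ∫ z in disk, inner ℝ (grad u z) v * b.normed volume (x - r⁻¹ • z) :=
    u.2 _ hψ v
  simp only [e3] at hw
  rw [e1, integral_smul_indicator_comp_smul r hr0 (fun y => fderiv ℝ (b.normed volume) (x - y) v),
    e2, ← neg_eq_iff_eq_neg.2 hw, ← integral_neg, smul_eq_mul, mul_left_comm,
    ← integral_const_mul r]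
  congr 2
  ext z
  simp only [smul_eq_mul]
  field_simp

theorem gradient_smoothing (u : H1 disk) (b : ContDiffBump (0 : Plane)) (hb : b.rOut ≤ 1 / 2)
    {x : Plane} (hx : x ∈ disk) :
    gradient (smoothing b (disk.indicator (fn u))) x
      = (1 - b.rOut) • smoothing b (disk.indicator (grad u)) x := by
  refine ext_inner_right ℝ fun v => ?_
  rw [inner_gradient, fderiv_smoothing_apply u b hb hx, real_inner_smul_left]

theorem contDiff_smoothing (u : H1 disk) (b : ContDiffBump (0 : Plane)) (hb : b.rOut ≤ 1 / 2) :
    ContDiff ℝ ∞ (smoothing b (disk.indicator (fn u))) :=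
  b.hasCompactSupport_normed.contDiff_convolution_left (lsmul ℝ ℝ) (b.contDiff_normed (n := ⊤))
    ((memLp_comp_smul (by linarith) (stronglyMeasurable_indicator_disk _)
      (memLp_indicator_disk _)).locallyIntegrable one_le_two)

/-- Functions smooth up to the boundary are dense in `H¹(B₁(0))`. -/
theorem exists_isSmoothPair_norm_sub_le (u : H1 disk) {κ : ℝ} (hκ : 0 < κ) :
    ∃ φ v g, IsSmoothPair φ v g ∧ ‖v - u‖ ≤ κ := by
  set δ : NNReal := ⟨κ / 3, by positivity⟩
  have hδ0 : 0 < δ := NNReal.coe_pos.1 (div_pos hκ three_pos)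
  obtain ⟨ε₁, hε₁, h₁⟩ := exists_forall_eLpNorm_smoothing_sub_le
    (stronglyMeasurable_indicator_disk (fn u)) (memLp_indicator_disk _) hδ0
  obtain ⟨ε₂, hε₂, h₂⟩ := exists_forall_eLpNorm_smoothing_sub_le
    (stronglyMeasurable_indicator_disk (grad u)) (memLp_indicator_disk _) hδ0
  -- The last condition absorbs the factor `1 - ε` in the gradient of the smoothed function.
  obtain ⟨ε, hε0, hεle⟩ : ∃ ε > 0, ε ≤ ε₁ ∧ ε ≤ ε₂ ∧ ε ≤ 1 / 2 ∧ ε * ‖grad u‖ ≤ κ / 3 := by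
    have hp : 0 < κ / 3 / (‖grad u‖ + 1) := by positivity
    refine ⟨min (min ε₁ ε₂) (min (1 / 2) (κ / 3 / (‖grad u‖ + 1))), by positivity, ?_, ?_, ?_, ?_⟩
    · exact (min_le_left _ _).trans (min_le_left _ _)
    · exact (min_le_left _ _).trans (min_le_right _ _)
    · exact (min_le_right _ _).trans (min_le_left _ _)
    · calc _ ≤ κ / 3 / (‖grad u‖ + 1) * (‖grad u‖ + 1) := by
            gcongr
            · exact (min_le_right _ _).trans (min_le_right _ _)
            · linarith
        _ = κ / 3 := by field_simp
  obtain ⟨l1, l2, l3, l4⟩ := hεle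
  let b : ContDiffBump (0 : Plane) := ⟨ε / 2, ε, by positivity, by linarith⟩
  have hb : b.rOut ≤ 1 / 2 := l3
  have hr : b.rOut = ε := rfl
  obtain ⟨v, g, hv⟩ := exists_isSmoothPair (contDiff_smoothing u b hb)
  refine ⟨_, v, g, hv, ?_⟩
  have hfn : ‖fn v - fn u‖ ≤ κ / 3 := by
    rw [Lp.norm_def]
    refine ENNReal.toReal_le_of_le_ofReal (by positivity) ?_
    have : ENNReal.ofReal (κ / 3) = δ := by
      rw [← ENNReal.ofReal_coe_nnreal]; rfl
    rw [this]
    refine (eLpNorm_congr_ae ?_).trans_le (h₁ b l1)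
    filter_upwards [Lp.coeFn_sub (fn v) (fn u), hv.fn_ae, ae_restrict_mem measurableSet_ball]
      with x h1 h2 h3
    rw [h1, Pi.sub_apply, h2, Pi.sub_apply, Set.indicator_of_mem h3]
  have hgrad : ‖(grad v - grad u) + ε • grad u‖ ≤ κ / 3 := by
    rw [Lp.norm_def]
    refine ENNReal.toReal_le_of_le_ofReal (by positivity) ?_
    have : ENNReal.ofReal (κ / 3) = δ := by
      rw [← ENNReal.ofReal_coe_nnreal]; rfl
    rw [this]
    refine (eLpNorm_mono_ae ?_).trans (h₂ b l2)
    filter_upwards [Lp.coeFn_add (grad v - grad u) (ε • grad u), Lp.coeFn_smul ε (grad u),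
      Lp.coeFn_sub (grad v) (grad u), hv.grad_ae, ae_restrict_mem measurableSet_ball]
      with x h0 h0' h1 h2 h3
    rw [h0, Pi.add_apply, h0', h1, Pi.sub_apply, h2, gradient_smoothing u b hb h3, Pi.sub_apply,
      Set.indicator_of_mem h3, Pi.smul_apply, hr]
    have e : (1 - ε) • smoothing b (disk.indicator (grad u)) x - grad u x + ε • grad u x
        = (1 - ε) • (smoothing b (disk.indicator (grad u)) x - grad u x) := by module
    rw [e, norm_smul, Real.norm_of_nonneg (by linarith)]
    exact mul_le_of_le_one_left (norm_nonneg _) (by linarith)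
  have hgrad' : ‖grad v - grad u‖ ≤ 2 * (κ / 3) := by
    have e : grad v - grad u = ((grad v - grad u) + ε • grad u) - ε • grad u := by abel
    rw [e]
    refine (norm_sub_le _ _).trans ?_
    rw [norm_smul, Real.norm_of_nonneg hε0.le]
    linarith
  have h := H1_norm_sq (v - u)
  have h' : ‖v - u‖ ^ 2 = ‖fn v - fn u‖ ^ 2 + ‖grad v - grad u‖ ^ 2 := h
  refine abs_le_of_sq_le_sq' ?_ hκ.le |>.2
  -- The total is at most `(κ/3)² + (2κ/3)² = 5κ²/9`.
  rw [h']
  nlinarith [norm_nonneg (fn v - fn u), norm_nonneg (grad v - grad u)]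

end Density

/-! ### The trace operator -/

theorem IsSmoothPair.sub {φ ψ : Plane → ℝ} {u v : H1 disk} {g k : L2Bdry}
    (h : IsSmoothPair φ u g) (h' : IsSmoothPair ψ v k) :
    IsSmoothPair (φ + (-1 : ℝ) • ψ) (u - v) (g - k) := by
  have e1 : u - v = u + (-1 : ℝ) • v := by module
  have e2 : g - k = g + (-1 : ℝ) • k := by module
  rw [e1, e2]
  exact h.add (h'.smul (-1))

/-- The graph of the trace operator. -/
def traceGraph : Submodule ℝ (H1 disk × L2Bdry) := smoothTraceGraph.topologicalClosure

namespace IsSmoothPair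

variable {φ : Plane → ℝ} {v : H1 disk} {k : L2Bdry}

theorem mem_traceGraph (h : IsSmoothPair φ v k) : (v, k) ∈ traceGraph :=
  smoothTraceGraph.le_topologicalClosure ⟨φ, h⟩

theorem integral_sub_fn_sq (h : IsSmoothPair φ v k) (u : H1 disk) :
    ∫ x in disk, (φ x - fn u x) ^ 2 = ‖fn (v - u)‖ ^ 2 := by
  rw [norm_sq_eq_integral_sq]
  refine integral_congr_ae ?_
  filter_upwards [h.fn_ae, Lp.coeFn_sub (fn v) (fn u)] with x h1 h2
  rw [← h1]
  exact congrArg (· ^ 2) h2.symm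

theorem integral_sub_grad_sq (h : IsSmoothPair φ v k) (u : H1 disk) :
    ∫ x in disk, ‖gradient φ x - grad u x‖ ^ 2 = ‖grad (v - u)‖ ^ 2 := by
  rw [norm_sq_eq_integral]
  refine integral_congr_ae ?_
  filter_upwards [h.grad_ae, Lp.coeFn_sub (grad v) (grad u)] with x h1 h2
  rw [← h1]
  exact congrArg (‖·‖ ^ 2) h2.symm

theorem integral_sub_bdry_sq (h : IsSmoothPair φ v k) (g : L2Bdry) :
    ∫ s : circle, (φ s - g s) ^ 2 ∂arcLength = ‖k - g‖ ^ 2 := by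
  rw [norm_sq_eq_integral_sq]
  refine integral_congr_ae ?_
  filter_upwards [h.bdry_ae, Lp.coeFn_sub k g] with x h1 h2
  rw [← h1]
  exact congrArg (· ^ 2) h2.symm

end IsSmoothPair

theorem tendsto_of_tendsto_norm_sub_sq {E : Type*} [SeminormedAddCommGroup E] {f : ℕ → E} {a : E}
    (h : Tendsto (fun n => ‖f n - a‖ ^ 2) atTop (𝓝 0)) : Tendsto f atTop (𝓝 a) := by
  rw [tendsto_iff_norm_sub_tendsto_zero]
  simpa using h.sqrt

theorem isTrace_iff_mem_traceGraph {u : H1 disk} {g : L2Bdry} :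
    IsTrace u g ↔ (u, g) ∈ traceGraph := by
  constructor
  · rintro ⟨φ, hφ, h1, h2, h3⟩
    choose v k hv using fun n => exists_isSmoothPair (hφ n)
    simp only [(hv _).integral_sub_fn_sq u] at h1
    simp only [(hv _).integral_sub_grad_sq u] at h2
    simp only [(hv _).integral_sub_bdry_sq g] at h3
    have t1 : Tendsto v atTop (𝓝 u) := by
      refine tendsto_of_tendsto_norm_sub_sq ?_
      simp only [H1_norm_sq]
      simpa using h1.add h2
    have t2 : Tendsto k atTop (𝓝 g) := tendsto_of_tendsto_norm_sub_sq h3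
    exact mem_closure_of_tendsto (t1.prodMk_nhds t2) (.of_forall fun n => ⟨φ n, hv n⟩)
  · intro h
    obtain ⟨q, hq, hlim⟩ := mem_closure_iff_seq_limit.1 h
    choose φ hφ using hq
    have t1 : Tendsto (fun n => (q n).1) atTop (𝓝 u) := (continuous_fst.tendsto _).comp hlim
    have t2 : Tendsto (fun n => (q n).2) atTop (𝓝 g) := (continuous_snd.tendsto _).comp hlim
    have t3 : Tendsto (fun n => (q n).1 - u) atTop (𝓝 0) := by simpa using t1.sub_const u
    refine ⟨φ, fun n => (hφ n).smooth, ?_, ?_, ?_⟩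
    · simp only [(hφ _).integral_sub_fn_sq u]
      have := ((continuous_fn.tendsto 0).comp t3).norm.pow 2
      simpa [show fn (0 : H1 disk) = 0 from rfl] using this
    · simp only [(hφ _).integral_sub_grad_sq u]
      have := ((continuous_grad.tendsto 0).comp t3).norm.pow 2
      simpa [show grad (0 : H1 disk) = 0 from rfl] using this
    · simp only [(hφ _).integral_sub_bdry_sq g]
      have := (t2.sub_const g).norm.pow 2
      simpa using this

/-- Density principle: a closed condition that holds for smooth pairs holds on the whole trace
graph. -/
theorem traceGraph_induction {p : H1 disk × L2Bdry → Prop} (hc : IsClosed {q | p q})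
    (hs : ∀ φ u g, IsSmoothPair φ u g → p (u, g)) {u : H1 disk} {g : L2Bdry}
    (h : (u, g) ∈ traceGraph) : p (u, g) :=
  closure_minimal (s := (smoothTraceGraph : Set _)) (t := {q | p q})
    (fun q hq => hq.elim fun φ hφ => hs φ q.1 q.2 hφ) hc
    (show (u, g) ∈ closure (smoothTraceGraph : Set (H1 disk × L2Bdry)) from h)

theorem norm_bdry_sq_le {u : H1 disk} {g : L2Bdry} (h : (u, g) ∈ traceGraph) :
    ‖g‖ ^ 2 ≤ 3 * ‖fn u‖ ^ 2 + ‖grad u‖ ^ 2 := by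
  have h1 := continuous_fn
  have h2 := continuous_grad
  refine traceGraph_induction (p := fun q => ‖q.2‖ ^ 2 ≤ 3 * ‖fn q.1‖ ^ 2 + ‖grad q.1‖ ^ 2)
    (isClosed_le (by fun_prop) (by fun_prop)) (fun φ u g h => h.norm_bdry_sq_le) h

theorem friedrichs {u : H1 disk} {g : L2Bdry} (h : (u, g) ∈ traceGraph) :
    ‖fn u‖ ^ 2 ≤ ‖grad u‖ ^ 2 + ‖g‖ ^ 2 := by
  have h1 := continuous_fn
  have h2 := continuous_grad
  refine traceGraph_induction (p := fun q => ‖fn q.1‖ ^ 2 ≤ ‖grad q.1‖ ^ 2 + ‖q.2‖ ^ 2)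
    (isClosed_le (by fun_prop) (by fun_prop)) (fun φ u g h => h.friedrichs) h

/-- By linearity `(0, g - g')` lies in the graph, and the trace estimate forces it to vanish. -/
theorem bdry_unique {u : H1 disk} {g g' : L2Bdry} (h : (u, g) ∈ traceGraph)
    (h' : (u, g') ∈ traceGraph) : g = g' := by
  have h0 : ((0 : H1 disk), g - g') ∈ traceGraph := by
    simpa using traceGraph.sub_mem h h'
  have := norm_bdry_sq_le h0
  have e : ‖g - g'‖ ^ 2 ≤ 0 := by
    simpa [show fn (0 : H1 disk) = 0 from rfl, show grad (0 : H1 disk) = 0 from rfl] using this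
  exact sub_eq_zero.1 (norm_eq_zero.1 (pow_eq_zero_iff two_ne_zero |>.1
    (le_antisymm e (sq_nonneg _))))

/-- The trace estimate makes the boundary values of an approximating smooth sequence Cauchy in `L²`
of the circle. -/
theorem exists_mem_traceGraph (u : H1 disk) : ∃ g, (u, g) ∈ traceGraph := by
  choose φ v k hv hle using fun n : ℕ => exists_isSmoothPair_norm_sub_le u
    (κ := 1 / ((n : ℝ) + 1)) (by positivity)
  have hlim : Tendsto v atTop (𝓝 u) := by
    rw [tendsto_iff_norm_sub_tendsto_zero]
    exact squeeze_zero (fun n => norm_nonneg _) hle tendsto_one_div_add_atTop_nhds_zero_nat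
  have hk : ∀ m n, ‖k m - k n‖ ≤ 2 * ‖v m - v n‖ := by
    intro m n
    have h1 := ((hv m).sub (hv n)).norm_bdry_sq_le
    have h2 := H1_norm_sq (v m - v n)
    refine abs_le_of_sq_le_sq' ?_ (by positivity) |>.2
    nlinarith [sq_nonneg ‖fn (v m - v n)‖, sq_nonneg ‖grad (v m - v n)‖]
  have hcau : CauchySeq k := by
    rw [Metric.cauchySeq_iff]
    intro ε hε
    obtain ⟨N, hN⟩ := Metric.cauchySeq_iff.1 hlim.cauchySeq (ε / 2) (by positivity)
    refine ⟨N, fun m hm n hn => ?_⟩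
    have := hN m hm n hn
    rw [dist_eq_norm] at this ⊢
    linarith [hk m n]
  obtain ⟨g, hg⟩ := cauchySeq_tendsto_of_complete hcau
  exact ⟨g, mem_closure_of_tendsto (hlim.prodMk_nhds hg) (.of_forall fun n => ⟨φ n, hv n⟩)⟩

theorem trace_mem_traceGraph (u : H1 disk) : (u, trace u) ∈ traceGraph := by
  have h : ∃ g, IsTrace u g :=
    (exists_mem_traceGraph u).imp fun _ => isTrace_iff_mem_traceGraph.2
  rw [trace, dif_pos h]
  exact isTrace_iff_mem_traceGraph.1 h.choose_spec

theorem trace_eq_of_mem {u : H1 disk} {g : L2Bdry} (h : (u, g) ∈ traceGraph) : trace u = g :=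
  bdry_unique (trace_mem_traceGraph u) h

theorem trace_add (u v : H1 disk) : trace (u + v) = trace u + trace v :=
  trace_eq_of_mem (traceGraph.add_mem (trace_mem_traceGraph u) (trace_mem_traceGraph v))

theorem trace_sub (u v : H1 disk) : trace (u - v) = trace u - trace v :=
  trace_eq_of_mem (traceGraph.sub_mem (trace_mem_traceGraph u) (trace_mem_traceGraph v))

theorem trace_smul (c : ℝ) (u : H1 disk) : trace (c • u) = c • trace u :=
  trace_eq_of_mem (traceGraph.smul_mem c (trace_mem_traceGraph u))

theorem H1_norm_sq_le (u : H1 disk) : ‖u‖ ^ 2 ≤ 2 * ‖grad u‖ ^ 2 + ‖trace u‖ ^ 2 := by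
  linarith [H1_norm_sq u, friedrichs (trace_mem_traceGraph u)]

/-- Gives uniqueness for both the Dirichlet and the Robin problem. -/
theorem eq_of_norm_sq_nonpos {u v : H1 disk} {a : ℝ} (ha : 0 < a)
    (h : ‖grad (u - v)‖ ^ 2 + a * ‖trace (u - v)‖ ^ 2 ≤ 0) : u = v := by
  have h1 : ‖trace (u - v)‖ ^ 2 ≤ 0 := by
    by_contra! hc
    nlinarith [sq_nonneg ‖grad (u - v)‖, mul_pos ha hc]
  have h2 : ‖grad (u - v)‖ ^ 2 ≤ 0 := by
    nlinarith [mul_nonneg ha.le (sq_nonneg ‖trace (u - v)‖)]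
  have h3 := H1_norm_sq_le (u - v)
  have h4 : ‖u - v‖ ^ 2 = 0 := le_antisymm (by linarith) (sq_nonneg _)
  exact sub_eq_zero.1 (norm_eq_zero.1 (pow_eq_zero_iff two_ne_zero |>.1 h4))

/-! ### Explicit solutions -/

theorem inner_eq_integral_mul {α : Type*} [MeasurableSpace α] {μ : Measure α} (f g : Lp ℝ 2 μ) :
    inner ℝ f g = ∫ x, f x * g x ∂μ := by
  rw [L2.inner_def]
  simp only [RCLike.inner_apply, conj_trivial, mul_comm]

theorem exists_isSmoothPair_one : ∃ c k, IsSmoothPair (fun _ => 1) c k :=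
  exists_isSmoothPair contDiff_const

namespace IsSmoothPair

variable {c : H1 disk} {k : L2Bdry}

theorem inner_fn (h : IsSmoothPair (fun _ => 1) c k) (u : H1 disk) :
    inner ℝ (fn c) (fn u) = ∫ x in disk, 1 * fn u x := by
  rw [inner_eq_integral_mul]
  refine integral_congr_ae ?_
  filter_upwards [h.fn_ae] with x hx
  rw [hx]

theorem inner_bdry (h : IsSmoothPair (fun _ => 1) c k) (g : L2Bdry) :
    inner ℝ k g = ∫ s, g s ∂arcLength := by
  rw [inner_eq_integral_mul]
  refine integral_congr_ae ?_
  filter_upwards [h.bdry_ae] with x hx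
  rw [hx, one_mul]

theorem grad_one (h : IsSmoothPair (fun _ => 1) c k) : grad c = 0 := by
  have := h.norm_grad_sq
  simpa [gradient] using this

theorem norm_one_sq (h : IsSmoothPair (fun _ => 1) c k) : ‖c‖ ^ 2 = Real.pi := by
  rw [H1_norm_sq, h.grad_one, h.norm_fn_sq]
  simp [Measure.real, Real.pi_pos.le]

end IsSmoothPair

/-- The solution of `-Δu = 1` with zero boundary values. -/
def parabola (x : Plane) : ℝ := (1 - ‖x‖ ^ 2) / 4

theorem gradient_parabola (x : Plane) : gradient parabola x = -(1 / 2 : ℝ) • x := by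
  refine ext_inner_right ℝ fun v => ?_
  have e : parabola = (4 : ℝ)⁻¹ • fun x : Plane => 1 - ‖x‖ ^ 2 := by
    ext y
    simp [parabola, div_eq_inv_mul]
  have h := ((hasStrictFDerivAt_norm_sq x).hasFDerivAt.const_sub 1).const_smul (4 : ℝ)⁻¹
  rw [inner_gradient, e, h.fderiv, real_inner_smul_left]
  simp
  ring

theorem exists_isSmoothPair_parabola : ∃ p, IsSmoothPair parabola p 0 := by
  have hs : ContDiff ℝ ∞ parabola := (contDiff_const.sub (contDiff_norm_sq ℝ)).div_const 4
  obtain ⟨p, g, hp⟩ := exists_isSmoothPair hs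
  have : g = 0 := by
    refine Lp.ext ?_
    filter_upwards [hp.bdry_ae, Lp.coeFn_zero ℝ 2 arcLength] with s h1 h2
    rw [h1, h2]
    simp [parabola]
  exact ⟨p, this ▸ hp⟩

/-- Weak equation of the paraboloid with its normal derivative `-1/2` kept as a boundary term. That
term drops out for Dirichlet test functions; for Robin it is matched by the constant `1/(4λ)`, since
`2λ · 1/(4λ) = 1/2`. -/
theorem inner_grad_parabola {p c : H1 disk} {k : L2Bdry} (hp : IsSmoothPair parabola p 0)
    (hc : IsSmoothPair (fun _ => 1) c k) (u : H1 disk) :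
    inner ℝ (grad p) (grad u) + 1 / 2 * inner ℝ k (trace u) = inner ℝ (fn c) (fn u) := by
  have h1 := continuous_fn
  have h2 := continuous_grad
  refine traceGraph_induction (p := fun q => inner ℝ (grad p) (grad q.1)
    + 1 / 2 * inner ℝ k q.2 = inner ℝ (fn c) (fn q.1)) (isClosed_eq (by fun_prop) (by fun_prop))
    (fun φ u g h => ?_) (trace_mem_traceGraph u)
  have e : inner ℝ (grad p) (grad u) = ∫ x in disk, inner ℝ (-(1 / 2 : ℝ) • x) (grad u x) := by
    rw [L2.inner_def]
    refine integral_congr_ae ?_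
    filter_upwards [hp.grad_ae] with x hx
    rw [hx, gradient_parabola]
  simp only [e, hc.inner_fn, hc.inner_bdry, h.green, one_mul]
  ring

theorem IsDirichletSolution.eq_parabola {p c : H1 disk} {k : L2Bdry}
    (hp : IsSmoothPair parabola p 0) (hc : IsSmoothPair (fun _ => 1) c k)
    {u : H1 disk} (hu : IsDirichletSolution (fun _ => 1) u) :
    u = p := by
  have ht : trace (u - p) = 0 := by
    rw [trace_sub, hu.1, trace_eq_of_mem hp.mem_traceGraph, sub_zero]
  have h1 := hu.2 _ ht
  rw [← hc.inner_fn, ← L2.inner_def] at h1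
  have h2 := inner_grad_parabola hp hc (u - p)
  have h3 : ‖grad (u - p)‖ ^ 2 =
      inner ℝ (grad u) (grad (u - p)) - inner ℝ (grad p) (grad (u - p)) := by
    rw [← inner_sub_left, ← real_inner_self_eq_norm_sq]; rfl
  refine eq_of_norm_sq_nonpos one_pos ?_
  rw [h3, h1, ← h2, ht]
  simp

theorem IsRobinSolution.eq_parabola_add_const {p c : H1 disk} {k : L2Bdry}
    (hp : IsSmoothPair parabola p 0) (hc : IsSmoothPair (fun _ => 1) c k)
    {lam : ℝ} (hlam : 0 < lam) {u : H1 disk}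
    (hu : IsRobinSolution lam (fun _ => 1) u) : u = p + (1 / (4 * lam)) • c := by
  set q := p + (1 / (4 * lam)) • c with hq
  have h1 := hu (u - q)
  rw [← hc.inner_fn, ← L2.inner_def, ← inner_eq_integral_mul] at h1
  have h2 := inner_grad_parabola hp hc (u - q)
  have hg : grad q = grad p := by
    change grad p + (1 / (4 * lam)) • grad c = _
    rw [hc.grad_one, smul_zero, add_zero]
  have ht : trace q = (1 / (4 * lam)) • k := by
    rw [hq, trace_add, trace_smul, trace_eq_of_mem hp.mem_traceGraph,
      trace_eq_of_mem hc.mem_traceGraph, zero_add]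
  have h3 : ‖grad (u - q)‖ ^ 2 =
      inner ℝ (grad u) (grad (u - q)) - inner ℝ (grad p) (grad (u - q)) := by
    rw [← hg, ← inner_sub_left, ← real_inner_self_eq_norm_sq]; rfl
  have h4 : ‖trace (u - q)‖ ^ 2
      = inner ℝ (trace u) (trace (u - q)) - 1 / (4 * lam) * inner ℝ k (trace (u - q)) := by
    rw [← real_inner_smul_left, ← ht, ← inner_sub_left, ← trace_sub, real_inner_self_eq_norm_sq]
  refine eq_of_norm_sq_nonpos (a := 2 * lam) (by positivity) ?_
  rw [h3, h4]
  have : 2 * lam * (1 / (4 * lam) * inner ℝ k (trace (u - q))) = 1 / 2 * inner ℝ k (trace (u - q)) := by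
    field_simp
    ring
  linarith

theorem norm_sub_le_of_solutions {lam : ℝ} (hlam : 0 < lam) {u₀ uR : H1 disk}
    (h₀ : IsDirichletSolution (fun _ => 1) u₀) (hR : IsRobinSolution lam (fun _ => 1) uR) :
    ‖uR - u₀‖ ≤ Real.pi / (4 * lam) := by
  obtain ⟨p, hp⟩ := exists_isSmoothPair_parabola
  obtain ⟨c, k, hc⟩ := exists_isSmoothPair_one
  rw [IsDirichletSolution.eq_parabola hp hc h₀,
    IsRobinSolution.eq_parabola_add_const hp hc hlam hR, add_sub_cancel_left, norm_smul,
    Real.norm_of_nonneg (by positivity), one_div_mul_eq_div]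
  gcongr
  have h1 := hc.norm_one_sq
  -- The sharp value is `√π`; it is bounded by `π` because `π ≥ 1`.
  nlinarith [norm_nonneg c, Real.pi_gt_three]

/-! ### Energy identity and error estimate -/

/-- Expanding the quadratic energy about `uR`, the linear terms cancel by the Robin equation tested
with `v - uR`. -/
theorem energy_eq {lam : ℝ} {uR : H1 disk} (hR : IsRobinSolution lam (fun _ => 1) uR)
    (v : H1 disk) : energy lam (fun _ => 1) v = energy lam (fun _ => 1) uR
      + (1 / 2 * ‖grad (v - uR)‖ ^ 2 + lam * ‖trace (v - uR)‖ ^ 2) := by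
  obtain ⟨c, k, hc⟩ := exists_isSmoothPair_one
  have h1 := hR (v - uR)
  rw [← hc.inner_fn, ← L2.inner_def, ← inner_eq_integral_mul] at h1
  simp only [energy, ← hc.inner_fn, ← norm_sq_eq_integral, ← norm_sq_eq_integral_sq]
  have e1 : fn v = fn uR + fn (v - uR) := by
    change fn v = fn uR + (fn v - fn uR); abel
  have e2 : grad v = grad uR + grad (v - uR) := by
    change grad v = grad uR + (grad v - grad uR); abel
  have e3 : trace v = trace uR + trace (v - uR) := by
    rw [trace_sub]; abel
  have n2 := norm_add_sq_real (grad uR) (grad (v - uR))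
  have n3 := norm_add_sq_real (trace uR) (trace (v - uR))
  rw [← e2] at n2
  rw [← e3] at n3
  rw [n2, n3, e1, inner_add_right, ← h1]
  ring

theorem norm_sq_le_gap {Θ : Type*} {lam : ℝ} (hlam : 0 < lam) (u : Θ → H1 disk) {uR : H1 disk}
    (hR : IsRobinSolution lam (fun _ => 1) uR) (θ : Θ) :
    ‖u θ - uR‖ ^ 2 ≤ (8 + 10 * lam) / lam * gap lam (fun _ => 1) u θ
        + (4 + 5 * lam) / lam * ⨅ θ' : Θ, lamNormSq lam (u θ' - uR) := by
  have : Nonempty Θ := ⟨θ⟩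
  have hloss : ∀ θ', loss lam (fun _ => 1) u θ' = energy lam (fun _ => 1) uR
      + (1 / 2 * ‖grad (u θ' - uR)‖ ^ 2 + lam * ‖trace (u θ' - uR)‖ ^ 2) :=
    fun θ' => energy_eq hR (u θ')
  -- Needed for `⨅` on the reals to be a true infimum instead of the default `0`.
  have hbdd : BddBelow (Set.range (loss lam (fun _ => 1) u)) := by
    refine ⟨energy lam (fun _ => 1) uR, ?_⟩
    rintro _ ⟨θ', rfl⟩
    rw [hloss]
    have : 0 ≤ 1 / 2 * ‖grad (u θ' - uR)‖ ^ 2 + lam * ‖trace (u θ' - uR)‖ ^ 2 := by positivity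
    linarith
  have hgap : 0 ≤ gap lam (fun _ => 1) u θ := sub_nonneg.2 (ciInf_le hbdd θ)
  -- The left side equals `inf L - E(uR)`, which is at most the excess of every competitor `θ'`.
  have hJ : 1 / 2 * ‖grad (u θ - uR)‖ ^ 2 + lam * ‖trace (u θ - uR)‖ ^ 2
      - gap lam (fun _ => 1) u θ ≤ ⨅ θ' : Θ, lamNormSq lam (u θ' - uR) := by
    refine le_ciInf fun θ' => ?_
    have h1 := ciInf_le hbdd θ'
    rw [lamNormSq, ← norm_sq_eq_integral, ← norm_sq_eq_integral_sq, gap, hloss θ]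
    rw [hloss θ'] at h1
    linarith [sq_nonneg ‖grad (u θ' - uR)‖]
  have hK : 0 < (4 + 5 * lam) / lam := by positivity
  calc ‖u θ - uR‖ ^ 2 ≤ 2 * ‖grad (u θ - uR)‖ ^ 2 + ‖trace (u θ - uR)‖ ^ 2 := H1_norm_sq_le _
    _ ≤ (4 + 5 * lam) / lam
        * (1 / 2 * ‖grad (u θ - uR)‖ ^ 2 + lam * ‖trace (u θ - uR)‖ ^ 2) := by
      have e : (4 + 5 * lam) / lam
          * (1 / 2 * ‖grad (u θ - uR)‖ ^ 2 + lam * ‖trace (u θ - uR)‖ ^ 2)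
          = 2 / lam * ‖grad (u θ - uR)‖ ^ 2 + 5 / 2 * ‖grad (u θ - uR)‖ ^ 2
            + (4 + 5 * lam) * ‖trace (u θ - uR)‖ ^ 2 := by
        field_simp
        ring
      rw [e]
      have h1 : 0 ≤ 2 / lam * ‖grad (u θ - uR)‖ ^ 2 := by positivity
      have h2 : 0 ≤ lam * ‖trace (u θ - uR)‖ ^ 2 := by positivity
      nlinarith [sq_nonneg ‖grad (u θ - uR)‖, sq_nonneg ‖trace (u θ - uR)‖]
    _ ≤ (4 + 5 * lam) / lam
        * (gap lam (fun _ => 1) u θ + ⨅ θ' : Θ, lamNormSq lam (u θ' - uR)) := by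
      refine mul_le_mul_of_nonneg_left ?_ hK.le
      linarith
    _ ≤ _ := by
      -- The factor `2` on the gap is slack, affordable because the gap is nonnegative.
      have e : (8 + 10 * lam) / lam = 2 * ((4 + 5 * lam) / lam) := by ring
      rw [e]
      nlinarith [mul_nonneg hK.le hgap]

end DeepRitz

end

theorem mainTheorem2 {Θ : Type*} (lam : ℝ) (hlam : 0 < lam)
    (u : Θ → DeepRitz.H1 DeepRitz.disk) (u₀ uR : DeepRitz.H1 DeepRitz.disk)
    (h₀ : DeepRitz.IsDirichletSolution (fun _ => 1) u₀)
    (hR : DeepRitz.IsRobinSolution lam (fun _ => 1) uR) (θ : Θ) :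
    ‖u θ - u₀‖ ≤
      Real.sqrt ((8 + 10 * lam) / lam * DeepRitz.gap lam (fun _ => 1) u θ
        + (4 + 5 * lam) / lam * ⨅ θ' : Θ, DeepRitz.lamNormSq lam (u θ' - uR))
      + Real.pi / (4 * lam) := by
  calc ‖u θ - u₀‖ = ‖(u θ - uR) + (uR - u₀)‖ := by rw [sub_add_sub_cancel]
    _ ≤ ‖u θ - uR‖ + ‖uR - u₀‖ := norm_add_le _ _
    _ ≤ _ := add_le_add (Real.le_sqrt_of_sq_le (DeepRitz.norm_sq_le_gap hlam u hR θ))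
      (DeepRitz.norm_sub_le_of_solutions hlam h₀ hR)
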